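/- Consider spatial coded modulation (SCM) with $M$ transmit and $N$ receive antennas. A message is a vector $b$ of $\log_2 L=k+q\ge 1$ bits. Its first $k$ bits are mapped injectively to a nonzero codeword $\boldsymbol c\in\{0,1\}^M$ (the antenna activation pattern, of Hamming weight $w(\boldsymbol c)$), its last $q$ bits are mapped injectively to a symbol $s$ of a constellation with $2^q$ points and unit average power, and the vector $\boldsymbol x=\frac{1}{\sqrt{w(\boldsymbol c)}}\boldsymbol c\,s\in\mathbb C^M$ is transmitted. Let $b_1,\dots,b_L$ be the $L=2^{k+q}$ messages, $\boldsymbol x_1,\dots,\boldsymbol x_L$ the corresponding transmit vectors, and $d(\boldsymbol x_i,\boldsymbol x_j)$ the Hamming distance between $\boldsymbol x_i$ and $\boldsymbol x_j$ in terms of the bits they carry, i.e. the number of positions in which $b_i$ and $b_j$ differ. The received vector is $\boldsymbol r=\boldsymbol H\boldsymbol x+\boldsymbol u$, where the message is uniformly distributed, $\boldsymbol u\sim\mathcal{CN}(\boldsymbol 0,\sigma^2\boldsymbol I_N)$ with $\sigma>0$, the channel matrix $\boldsymbol H\in\mathbb C^{N\times M}$ is random with $\boldsymbol\omega=\mathrm{vec}(\boldsymbol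 H^\dagger)\sim\mathcal{CN}(\boldsymbol\mu,\boldsymbol\varSigma)$ circularly symmetric complex Gaussian with mean $\boldsymbol\mu$ and (positive semidefinite, possibly singular) covariance matrix $\boldsymbol\varSigma$, and the message, $\boldsymbol H$ and $\boldsymbol u$ are independent. The receiver knows $\boldsymbol H$ and uses maximum likelihood detection, i.e. it decides for a message whose transmit vector minimizes $\|\boldsymbol r-\boldsymbol H\boldsymbol x\|^2$ (ties being broken by any measurable rule). Then the bit error rate $P_{\mathrm e}$, that is, the probability that a bit is decided wrongly, averaged over the $\log_2 L$ bit positions, satisfies $$P_{\mathrm e}\le\frac{1}{\pi L\log_2 L}\,\mathcal G(\sigma,\boldsymbol\mu,\boldsymbol\varSigma),$$ where $$\mathcal G(\sigma,\boldsymbol\mu,\boldsymbol\varSigma)=\sum_{i=1}^L\sum_{j=1}^L d(\boldsymbol x_i,\boldsymbol x_j)\int_0^{\pi/2}\frac{\exp\!\Big(-\frac{1}{4\sigma^2\sin^2\theta}\,\boldsymbol\mu^\dagger\boldsymbol A_{ij}\big(\boldsymbol I+\frac{1}{4\sigma^2\sin^2\theta}\boldsymbol\varSigma\boldsymbol A_{ij}\big)^{-1}\boldsymbol\mu\Big)}{\det\!\big(\boldsymbol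 I+\frac{1}{4\sigma^2\sin^2\theta}\boldsymbol\varSigma\boldsymbol A_{ij}\big)}\,d\theta,$$ $$\boldsymbol A_{ij}=\boldsymbol I_N\otimes\boldsymbol\delta_{ij}\boldsymbol\delta_{ij}^\dagger,\qquad \boldsymbol\delta_{ij}=\boldsymbol x_i-\boldsymbol x_j .$$ -/

import Mathlib

open MeasureTheory ProbabilityTheory
open scoped Matrix Kronecker ComplexOrder

noncomputable section

/-- The Borel (product) measurable structure on complex matrices. -/
instance complexMatrixMeasurableSpace {m n : Type*} : MeasurableSpace (Matrix m n ℂ) :=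
  inferInstanceAs (MeasurableSpace (m → n → ℂ))

/-- `X` is a circularly symmetric (proper) complex Gaussian random vector `CN(μ, C)` with mean `μ`
and covariance matrix `C = E[(X - μ)(X - μ)†]`: `C` is Hermitian positive semidefinite, and each
real linear functional `Re (a† X)` is a real Gaussian variable with mean `Re (a† μ)` and variance
`a† C a / 2`. A singular `C` is allowed. -/
def IsComplexGaussian {Ω ι : Type*} [MeasurableSpace Ω] [Fintype ι]
    (X : Ω → ι → ℂ) (μ : ι → ℂ) (C : Matrix ι ι ℂ) (P : Measure Ω) : Prop :=
  C.PosSemidef ∧ AEMeasurable X P ∧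
    ∀ a : ι → ℂ, P.map (fun ω => (star a ⬝ᵥ X ω).re) =
      gaussianReal (star a ⬝ᵥ μ).re (Real.toNNReal ((star a ⬝ᵥ (C *ᵥ a)).re / 2))

/-- A spatial coded modulation scheme with `M` transmit antennas, carrying `k` bits in the antenna
activation pattern and `q` bits in the modulated symbol. -/
structure SCM (M k q : ℕ) where
  /-- The encoder of the `(M, k)` antenna codebook. -/
  encode : (Fin k → Bool) → (Fin M → Bool)
  /-- The codebook has `2 ^ k` codewords. -/
  encode_injective : Function.Injective encode
  /-- The all-zero codeword is excluded: some antenna is active. -/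
  encode_ne_zero : ∀ b, ∃ l, encode b l = true
  /-- The bit-to-symbol map of the amplitude/phase constellation. -/
  modulate : (Fin q → Bool) → ℂ
  /-- The constellation has `2 ^ q` points. -/
  modulate_injective : Function.Injective modulate
  /-- The constellation has unit average power. -/
  modulate_power : (∑ b, ‖modulate b‖ ^ 2) / 2 ^ q = 1

namespace SCM

variable {M k q : ℕ}

/-- The Hamming weight of a codeword. -/
def weight (c : Fin M → Bool) : ℕ := (Finset.univ.filter fun l => c l = true).card

/-- The codeword carried by a bit vector (its first `k` bits are encoded). -/
def codeword (S : SCM M k q) (b : Fin (k + q) → Bool) : Fin M → Bool :=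
  S.encode fun i => b (Fin.castAdd q i)

/-- The modulated symbol carried by a bit vector (its last `q` bits are modulated). -/
def apm (S : SCM M k q) (b : Fin (k + q) → Bool) : ℂ :=
  S.modulate fun i => b (Fin.natAdd k i)

/-- The transmitted vector `x = c s / √(w(c))` of a bit vector. The `L = 2 ^ (k + q)` transmit
vectors are indexed by the bit vectors that they carry. -/
def symbol (S : SCM M k q) (b : Fin (k + q) → Bool) : Fin M → ℂ := fun l =>
  (1 / (Real.sqrt (weight (S.codeword b)) : ℂ)) * (if S.codeword b l = true then 1 else 0) *
    S.apm b

/-- The difference `δ = x_i - x_j` of two transmit vectors. -/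
def delta (S : SCM M k q) (i j : Fin (k + q) → Bool) : Fin M → ℂ := S.symbol i - S.symbol j

/-- The matrix `A_ij = I_N ⊗ δ δ†`. -/
def quadMatrix (S : SCM M k q) (N : ℕ) (i j : Fin (k + q) → Bool) :
    Matrix (Fin N × Fin M) (Fin N × Fin M) ℂ :=
  (1 : Matrix (Fin N) (Fin N) ℂ) ⊗ₖ Matrix.vecMulVec (S.delta i j) (star (S.delta i j))

/-- A maximum likelihood detector with perfect knowledge of the channel: a measurable rule that maps
the channel matrix `H` and the received vector `r` to a minimizer of the Euclidean distance
`‖r - H x‖²` over all transmit vectors, with ties broken in any measurable way. -/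
def IsMLDetector (S : SCM M k q) {N : ℕ}
    (D : Matrix (Fin N) (Fin M) ℂ → (Fin N → ℂ) → (Fin (k + q) → Bool)) : Prop :=
  Measurable (Function.uncurry D) ∧
    ∀ (H : Matrix (Fin N) (Fin M) ℂ) (r : Fin N → ℂ) (b : Fin (k + q) → Bool),
      ‖(WithLp.toLp 2 (r - H *ᵥ S.symbol (D H r)) : EuclideanSpace ℂ (Fin N))‖ ^ 2 ≤
        ‖(WithLp.toLp 2 (r - H *ᵥ S.symbol b) : EuclideanSpace ℂ (Fin N))‖ ^ 2

/-- The bit error rate when the bit vector `m` is sent over the channel `H` with noise `u` and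
detected by `D` from `r = H x + u`: the error probability of a bit, averaged over the bit
positions. -/
def ber (S : SCM M k q) {N : ℕ} {Ω : Type*} [MeasurableSpace Ω] (P : Measure Ω)
    (D : Matrix (Fin N) (Fin M) ℂ → (Fin N → ℂ) → (Fin (k + q) → Bool))
    (m : Ω → Fin (k + q) → Bool) (H : Ω → Matrix (Fin N) (Fin M) ℂ) (u : Ω → Fin N → ℂ) : ℝ :=
  (∑ t : Fin (k + q), P.real {ω | D (H ω) (H ω *ᵥ S.symbol (m ω) + u ω) t ≠ m ω t}) /
    ((k + q : ℕ) : ℝ)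

/-- The function `G(σ, μ, C)`. For positive semidefinite `C` the quadratic form in the exponent and
the determinant are real numbers, read off here as real parts. -/
def G (S : SCM M k q) {N : ℕ} (σ : ℝ) (μ : Fin N × Fin M → ℂ)
    (C : Matrix (Fin N × Fin M) (Fin N × Fin M) ℂ) : ℝ :=
  ∑ i : Fin (k + q) → Bool, ∑ j : Fin (k + q) → Bool, (hammingDist i j : ℝ) *
    ∫ θ in (0 : ℝ)..(Real.pi / 2),
      Real.exp (-(1 / (4 * σ ^ 2 * Real.sin θ ^ 2)) *
          (star μ ⬝ᵥ ((S.quadMatrix N i j *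
            (1 + ((1 / (4 * σ ^ 2 * Real.sin θ ^ 2) : ℝ) : ℂ) • (C * S.quadMatrix N i j))⁻¹)
              *ᵥ μ)).re) /
        (1 + ((1 / (4 * σ ^ 2 * Real.sin θ ^ 2) : ℝ) : ℂ) • (C * S.quadMatrix N i j)).det.re

end SCM

end

/-!
The bit error rate is the sum over ordered pairs of messages `(i, j)` of the probability that `j` is
decided when `i` is sent, weighted by their Hamming distance (`SCM.ber_eq`). The pairs are bounded
separately, in a symmetrized form that takes care of ties.

For a fixed channel `h`, if `h x_i ≠ h x_j`, then deciding `j` although `i` was sent forces the real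
Gaussian variable `Re (z† u)`, `z = -h δ_ij`, to exceed `‖z‖² / 2`. The Gaussian tail is evaluated by
Craig's formula `Q(x) = π⁻¹ ∫_0^{π/2} exp (-x² / (2 sin² θ)) dθ`
(`gaussianReal_real_Ici_eq_integral`), which follows by writing the half-plane probability in polar
coordinates. If `h x_i = h x_j`, which can happen with positive probability (a singular law of the
channel, or a constellation containing `0`), a tie-breaking rule may always decide for `j`, and the
bound fails for the ordered pair `(i, j)` alone. But then the two messages produce the same law of
the received vector, so the probabilities of `i → j` and `j → i` sum to at most `1`, which is twice
the value `1 / 2` of the bound at `δ = 0`. Since the Hamming distance is symmetric, a bound on the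
sum over both orders (`SCM.IsMLDetector.pairwise_error_add_le`) is enough.

Averaging over the channel and exchanging the integrals leaves `E exp (-s ‖H δ‖²)` with
`s = 1 / (4 σ² sin² θ)`. Here `‖H δ‖²` is the quadratic form `ω† A ω` of `ω = vec (H†)`, and
`IsComplexGaussian.integral_exp_neg_quadForm` evaluates this Laplace transform for every positive
semidefinite `A` and every, possibly singular, covariance matrix `C`: one factors `A = B† B` with
`B C B†` diagonal, so that the coordinates of `B ω` have independent Gaussian real and imaginary
parts, multiplies the one-dimensional integrals, and returns to `C` and `A` by
`det (1 + C B† B) = det (1 + B C B†)` and `B† B (1 + C B† B)⁻¹ = B† (1 + B C B†)⁻¹ B`.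
-/

open scoped NNReal

/-! ### Laplace transforms of squares of Gaussian variables -/

/-- The Laplace transform of the square of a Gaussian variable. Completing the square turns the
integrand into a multiple of another Gaussian density; variance `0` is the Dirac case. -/
lemma integral_exp_neg_mul_sq_gaussianReal (c : ℝ) (v : ℝ≥0) {s : ℝ} (hs : 0 ≤ s) :
    ∫ x, Real.exp (-s * x ^ 2) ∂(gaussianReal c v) =
      Real.exp (-s * c ^ 2 / (1 + 2 * s * v)) / √(1 + 2 * s * v) := by
  by_cases hv : v = 0
  · simp [hv]
  have hv' : (0 : ℝ) < v := by positivity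
  have hk : 0 < 1 + 2 * s * (v : ℝ) := by positivity
  rw [integral_gaussianReal_eq_integral_smul hv]
  set w : ℝ≥0 := ⟨v / (1 + 2 * s * v), by positivity⟩ with hw
  have hwv : (w : ℝ) = v / (1 + 2 * s * v) := rfl
  have hw0 : w ≠ 0 := by
    rw [← NNReal.coe_ne_zero, hwv]; positivity
  have key : ∀ x : ℝ, gaussianPDFReal c v x • Real.exp (-s * x ^ 2) =
      (Real.exp (-s * c ^ 2 / (1 + 2 * s * v)) / √(1 + 2 * s * v)) *
        gaussianPDFReal (c / (1 + 2 * s * v)) w x := by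
    intro x
    simp only [gaussianPDFReal, smul_eq_mul, hwv]
    have h1 : √(2 * Real.pi * (v / (1 + 2 * s * v))) =
        √(2 * Real.pi * v) / √(1 + 2 * s * v) := by
      rw [← Real.sqrt_div (by positivity), mul_div_assoc]
    have h2 : Real.exp (-(x - c) ^ 2 / (2 * v)) * Real.exp (-s * x ^ 2) =
        Real.exp (-s * c ^ 2 / (1 + 2 * s * v)) *
          Real.exp (-(x - c / (1 + 2 * s * v)) ^ 2 / (2 * (v / (1 + 2 * s * v)))) := by
      rw [← Real.exp_add, ← Real.exp_add]
      congr 1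
      field_simp
      ring
    rw [mul_assoc, h2, h1]
    have := Real.sqrt_pos.2 hk
    field_simp
  simp_rw [key]
  rw [integral_const_mul, integral_gaussianPDFReal_eq_one _ hw0, mul_one]

/-- If the linear combinations of real variables are Gaussian as for independent Gaussian variables,
then the variables are independent Gaussian: the joint characteristic function factors. -/
lemma iIndepFun_of_map_sum_eq_gaussianReal {Ω ι : Type*} [MeasurableSpace Ω] [Fintype ι]
    {P : Measure Ω} [IsProbabilityMeasure P] {X : ι → Ω → ℝ} (hX : ∀ i, AEMeasurable (X i) P)
    (c : ι → ℝ) (v : ι → ℝ≥0)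
    (h : ∀ a : ι → ℝ, P.map (fun ω => ∑ i, a i * X i ω) =
      gaussianReal (∑ i, a i * c i) (Real.toNNReal (∑ i, a i ^ 2 * v i))) :
    iIndepFun X P ∧ ∀ i, P.map (X i) = gaussianReal (c i) (v i) := by
  classical
  have hm : ∀ i, P.map (X i) = gaussianReal (c i) (v i) := by
    intro i
    have := h (Pi.single i 1)
    simpa [Pi.single_apply, ite_pow] using this
  refine ⟨(iIndepFun_iff_charFun_pi hX).2 fun t => ?_, hm⟩
  have h1 : charFun (P.map fun ω => WithLp.toLp 2 (X · ω)) t =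
      charFun (P.map (fun ω => ∑ i, t i * X i ω)) 1 := by
    rw [charFun_apply, charFun_apply, integral_map (by fun_prop) (by fun_prop),
      integral_map (by fun_prop) (by fun_prop)]
    simp [PiLp.inner_apply, mul_comm]
  rw [h1, h, charFun_gaussianReal]
  simp_rw [hm, charFun_gaussianReal]
  rw [← Complex.exp_sum, Real.coe_toNNReal _ (by positivity)]
  congr 1
  push_cast
  simp only [one_mul, one_pow, mul_one, Finset.sum_sub_distrib, Finset.sum_div, Finset.sum_mul]
  congr 1
  exact Finset.sum_congr rfl fun i _ => by ring

/-- The Laplace transform of the sum of squares of the independent Gaussian variables of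
`iIndepFun_of_map_sum_eq_gaussianReal`. -/
lemma integral_exp_neg_mul_sum_sq {Ω ι : Type*} [MeasurableSpace Ω] [Fintype ι]
    {P : Measure Ω} [IsProbabilityMeasure P] {X : ι → Ω → ℝ} (hX : ∀ i, AEMeasurable (X i) P)
    (c : ι → ℝ) (v : ι → ℝ≥0)
    (h : ∀ a : ι → ℝ, P.map (fun ω => ∑ i, a i * X i ω) =
      gaussianReal (∑ i, a i * c i) (Real.toNNReal (∑ i, a i ^ 2 * v i)))
    {s : ℝ} (hs : 0 ≤ s) :
    ∫ ω, Real.exp (-s * ∑ i, X i ω ^ 2) ∂P =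
      ∏ i, (Real.exp (-s * c i ^ 2 / (1 + 2 * s * v i)) / √(1 + 2 * s * v i)) := by
  obtain ⟨hind, hm⟩ := iIndepFun_of_map_sum_eq_gaussianReal hX c v h
  simp_rw [Finset.mul_sum, Real.exp_sum]
  rw [hind.integral_fun_prod_comp (f := fun _ x => Real.exp (-s * x ^ 2)) hX
    (fun i => by fun_prop)]
  refine Finset.prod_congr rfl fun i _ => ?_
  rw [← integral_exp_neg_mul_sq_gaussianReal _ _ hs, ← hm,
    integral_map (hX i) (by fun_prop)]

/-! ### Quadratic forms in complex Gaussian vectors -/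

/-- When `B C B†` is diagonal, the real and imaginary parts of the coordinates of `B X` are
independent, each of variance `l i / 2`; the two square roots in the Laplace transforms of the parts
multiply to `1 + s * l i`. -/
lemma IsComplexGaussian.integral_exp_neg_mul_sum_norm_mulVec_sq {Ω ι n : Type*} [MeasurableSpace Ω]
    [Fintype ι] [Fintype n] [DecidableEq n] {P : Measure Ω} [IsProbabilityMeasure P]
    {X : Ω → ι → ℂ} {μ : ι → ℂ} {C : Matrix ι ι ℂ} (hX : IsComplexGaussian X μ C P)
    (B : Matrix n ι ℂ) {l : n → ℝ} (hl : ∀ i, 0 ≤ l i)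
    (hB : B * C * Bᴴ = Matrix.diagonal fun i => (l i : ℂ)) {s : ℝ} (hs : 0 ≤ s) :
    ∫ ω, Real.exp (-s * ∑ i, ‖(B *ᵥ X ω) i‖ ^ 2) ∂P =
      ∏ i, (Real.exp (-s * ‖(B *ᵥ μ) i‖ ^ 2 / (1 + s * l i)) / (1 + s * l i)) := by
  obtain ⟨-, hXm, hXlaw⟩ := hX
  have hlin : ∀ (α : n → ℂ) (y : ι → ℂ), star (Bᴴ *ᵥ α) ⬝ᵥ y = star α ⬝ᵥ (B *ᵥ y) := by
    intro α y
    rw [Matrix.star_mulVec, Matrix.conjTranspose_conjTranspose, Matrix.dotProduct_mulVec]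
  have hdot : ∀ (a : n ⊕ n → ℝ) (y : n → ℂ),
      (star (fun i => (a (.inl i) : ℂ) + a (.inr i) * Complex.I) ⬝ᵥ y).re =
        ∑ j, a j * Sum.elim (fun i => (y i).re) (fun i => (y i).im) j := by
    intro a y
    simp [dotProduct, Fintype.sum_sum_type, Finset.sum_add_distrib]
  have hsq : ∀ y : n → ℂ, ∑ i, ‖y i‖ ^ 2 =
      ∑ j, Sum.elim (fun i => (y i).re) (fun i => (y i).im) j ^ 2 := by
    intro y
    simp only [Fintype.sum_sum_type, Sum.elim_inl, Sum.elim_inr, ← Finset.sum_add_distrib]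
    refine Finset.sum_congr rfl fun i _ => ?_
    rw [← Complex.normSq_eq_norm_sq, Complex.normSq_apply]
    ring
  have hBm : ∀ i, AEMeasurable (fun ω => (B *ᵥ X ω) i) P := by
    intro i
    simp only [Matrix.mulVec, dotProduct]
    fun_prop
  simp_rw [hsq]
  rw [integral_exp_neg_mul_sum_sq (c := Sum.elim (fun i => ((B *ᵥ μ) i).re)
      (fun i => ((B *ᵥ μ) i).im)) (v := Sum.elim (fun i => Real.toNNReal (l i / 2))
      (fun i => Real.toNNReal (l i / 2))) _ _ hs]
  · rw [Fintype.prod_sum_type, ← Finset.prod_mul_distrib]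
    refine Finset.prod_congr rfl fun i _ => ?_
    have hk : 1 + 2 * s * (Real.toNNReal (l i / 2) : ℝ) = 1 + s * l i := by
      rw [Real.coe_toNNReal _ (by linarith [hl i])]; ring
    have hpos : 0 < 1 + s * l i := by have := hl i; positivity
    simp only [Sum.elim_inl, Sum.elim_inr, hk]
    rw [div_mul_div_comm, ← Real.exp_add, Real.mul_self_sqrt hpos.le, ← add_div, ← mul_add,
      ← Complex.normSq_eq_norm_sq, Complex.normSq_apply, sq, sq]
  · rintro (i | i)
    · exact (hBm i).re
    · exact (hBm i).im
  · intro a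
    set α : n → ℂ := fun i => (a (.inl i) : ℂ) + a (.inr i) * Complex.I with hα
    have h := hXlaw (Bᴴ *ᵥ α)
    have hvar : (star (Bᴴ *ᵥ α) ⬝ᵥ (C *ᵥ (Bᴴ *ᵥ α))).re / 2 = ∑ j, a j ^ 2 *
        ((Sum.elim (fun i => Real.toNNReal (l i / 2)) (fun i => Real.toNNReal (l i / 2)) j :
          ℝ≥0) : ℝ) := by
      rw [hlin, Matrix.mulVec_mulVec, Matrix.mulVec_mulVec, hB, dotProduct, Complex.re_sum,
        Fintype.sum_sum_type, ← Finset.sum_add_distrib, Finset.sum_div]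
      refine Finset.sum_congr rfl fun i _ => ?_
      rw [Matrix.mulVec_diagonal]
      simp only [Sum.elim_inl, Sum.elim_inr]
      rw [Real.coe_toNNReal _ (by linarith [hl i])]
      simp [hα]
      ring
    rw [hvar] at h
    simp only [hlin, hα, hdot] at h
    exact h

lemma Matrix.PosSemidef.exists_unitary_conj_eq_diagonal {n : Type*} [Fintype n] [DecidableEq n]
    {A : Matrix n n ℂ} (hA : A.PosSemidef) :
    ∃ (U : Matrix n n ℂ) (l : n → ℝ), U * Uᴴ = 1 ∧ (∀ i, 0 ≤ l i) ∧
      Uᴴ * A * U = Matrix.diagonal fun i => (l i : ℂ) := by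
  refine ⟨hA.1.eigenvectorUnitary, hA.1.eigenvalues, Unitary.coe_mul_star_self _,
    hA.eigenvalues_nonneg, ?_⟩
  have h := hA.1.conjStarAlgAut_star_eigenvectorUnitary
  rw [Unitary.conjStarAlgAut_star_apply] at h
  exact h

/-- The Laplace transform of a positive semidefinite quadratic form `X† A X` in a complex Gaussian
vector `X ∼ CN(μ, C)`. No inverse of `C` occurs, so a singular `C` is allowed. -/
theorem IsComplexGaussian.integral_exp_neg_quadForm {Ω ι : Type*} [MeasurableSpace Ω]
    [Fintype ι] [DecidableEq ι] {P : Measure Ω} [IsProbabilityMeasure P]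
    {X : Ω → ι → ℂ} {μ : ι → ℂ} {C : Matrix ι ι ℂ} (hX : IsComplexGaussian X μ C P)
    {A : Matrix ι ι ℂ} (hA : A.PosSemidef) {s : ℝ} (hs : 0 ≤ s) :
    ∫ ω, Real.exp (-s * (star (X ω) ⬝ᵥ (A *ᵥ X ω)).re) ∂P =
      Real.exp (-s * (star μ ⬝ᵥ ((A * (1 + (s : ℂ) • (C * A))⁻¹) *ᵥ μ)).re) /
        (1 + (s : ℂ) • (C * A)).det.re := by
  obtain ⟨B₀, hB₀⟩ : ∃ B : Matrix ι ι ℂ, A = Bᴴ * B :=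
    by
    open scoped MatrixOrder in
    exact CStarAlgebra.nonneg_iff_eq_star_mul_self.mp hA.nonneg
  have hPSD : (B₀ * C * B₀ᴴ).PosSemidef := hX.1.mul_mul_conjTranspose_same B₀
  obtain ⟨U, l, hUU, hl0, hUl⟩ := hPSD.exists_unitary_conj_eq_diagonal
  -- Rotating the factor `B₀` of `A` by `U†` keeps `B† B = A` and makes `B C B†` diagonal.
  set B : Matrix ι ι ℂ := Uᴴ * B₀ with hBdef
  have hAB : A = Bᴴ * B := by
    rw [hBdef, Matrix.conjTranspose_mul, Matrix.conjTranspose_conjTranspose, Matrix.mul_assoc,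
      ← Matrix.mul_assoc U, hUU, Matrix.one_mul, hB₀]
  have hBC : B * C * Bᴴ = Matrix.diagonal fun i => (l i : ℂ) := by
    rw [hBdef, Matrix.conjTranspose_mul, Matrix.conjTranspose_conjTranspose, ← hUl]
    simp only [Matrix.mul_assoc]
  have hquad : ∀ y : ι → ℂ, (star y ⬝ᵥ (A *ᵥ y)).re = ∑ i, ‖(B *ᵥ y) i‖ ^ 2 := by
    intro y
    rw [hAB, ← Matrix.mulVec_mulVec, Matrix.dotProduct_mulVec, ← Matrix.star_mulVec, dotProduct,
      Complex.re_sum]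
    refine Finset.sum_congr rfl fun i _ => ?_
    rw [Pi.star_apply, ← Complex.normSq_eq_norm_sq, Complex.star_def,
      ← Complex.normSq_eq_conj_mul_self, Complex.ofReal_re]
  have hpos : ∀ i, 0 < 1 + s * l i := fun i => by have := hl0 i; positivity
  have hone : (1 : Matrix ι ι ℂ) + (s : ℂ) • (Matrix.diagonal fun i => (l i : ℂ)) =
      Matrix.diagonal fun i => ((1 + s * l i : ℝ) : ℂ) := by
    rw [← Matrix.diagonal_one, ← Matrix.diagonal_smul, Matrix.diagonal_add]
    congr 1
    ext i
    simp
  have hdet : (1 + (s : ℂ) • (C * A)).det = ((∏ i, (1 + s * l i) : ℝ) : ℂ) := by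
    rw [hAB, ← Matrix.mul_assoc, ← Matrix.smul_mul, Matrix.det_one_add_mul_comm, Matrix.mul_smul,
      ← Matrix.mul_assoc, hBC, hone, Matrix.det_diagonal, Complex.ofReal_prod]
  have hunit : IsUnit (1 + (s : ℂ) • (C * A)).det := by
    rw [hdet, isUnit_iff_ne_zero, Complex.ofReal_ne_zero]
    exact (Finset.prod_pos fun i _ => hpos i).ne'
  set E : Matrix ι ι ℂ := Matrix.diagonal fun i => (((1 + s * l i)⁻¹ : ℝ) : ℂ) with hE
  -- The push-through identity `B (1 + s C B† B) = (1 + s B C B†) B`.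
  have hBK : E * (B * (1 + (s : ℂ) • (C * A))) = B := by
    have : B * (1 + (s : ℂ) • (C * A)) =
        (Matrix.diagonal fun i => ((1 + s * l i : ℝ) : ℂ)) * B := by
      rw [← hone, ← hBC, hAB, Matrix.mul_add, Matrix.add_mul, Matrix.mul_one, Matrix.one_mul]
      simp only [Matrix.mul_smul, Matrix.smul_mul, Matrix.mul_assoc]
    rw [this, ← Matrix.mul_assoc, hE, Matrix.diagonal_mul_diagonal]
    have : (fun i => (((1 + s * l i)⁻¹ : ℝ) : ℂ) * ((1 + s * l i : ℝ) : ℂ)) = fun _ => 1 := by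
      ext i
      rw [← Complex.ofReal_mul, inv_mul_cancel₀ (hpos i).ne', Complex.ofReal_one]
    rw [this, Matrix.diagonal_one, Matrix.one_mul]
  have hinv : A * (1 + (s : ℂ) • (C * A))⁻¹ = Bᴴ * (E * B) := by
    have h : B * (1 + (s : ℂ) • (C * A))⁻¹ = E * B := by
      conv_lhs => rw [← hBK]
      rw [Matrix.mul_assoc, Matrix.mul_assoc, Matrix.mul_nonsing_inv _ hunit, Matrix.mul_one]
    rw [← h, ← Matrix.mul_assoc, ← hAB]
  have hmu : (star μ ⬝ᵥ ((A * (1 + (s : ℂ) • (C * A))⁻¹) *ᵥ μ)).re =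
      ∑ i, ‖(B *ᵥ μ) i‖ ^ 2 / (1 + s * l i) := by
    rw [hinv, ← Matrix.mulVec_mulVec, Matrix.dotProduct_mulVec, ← Matrix.star_mulVec,
      ← Matrix.mulVec_mulVec μ E B, dotProduct, Complex.re_sum]
    refine Finset.sum_congr rfl fun i _ => ?_
    rw [hE, Matrix.mulVec_diagonal, Pi.star_apply, mul_left_comm, ← Complex.normSq_eq_norm_sq,
      Complex.star_def, ← Complex.normSq_eq_conj_mul_self, ← Complex.ofReal_mul, Complex.ofReal_re,
      div_eq_inv_mul]
  simp_rw [hquad]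
  rw [hX.integral_exp_neg_mul_sum_norm_mulVec_sq B hl0 hBC hs, hmu, hdet, Complex.ofReal_re,
    Finset.prod_div_distrib, ← Real.exp_sum, Finset.mul_sum]
  simp_rw [mul_div_assoc]

/-! ### Craig's formula -/

lemma lintegral_Ici_mul_exp_neg_sq {b v : ℝ} (hv : 0 < v) (hb : 0 ≤ b) :
    ∫⁻ r in Set.Ici b, ENNReal.ofReal (r * Real.exp (-r ^ 2 / (2 * v))) =
      ENNReal.ofReal (v * Real.exp (-b ^ 2 / (2 * v))) := by
  have hderiv : ∀ r ∈ Set.Ici b, HasDerivAt (fun r => -v * Real.exp (-r ^ 2 / (2 * v)))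
      (r * Real.exp (-r ^ 2 / (2 * v))) r := by
    intro r _
    have h := ((((hasDerivAt_pow 2 r).neg).div_const (2 * v)).exp).const_mul (-v)
    refine h.congr_deriv ?_
    simp only [Pi.neg_apply]
    field_simp
    push_cast
    ring
  have hnn : ∀ r ∈ Set.Ioi b, 0 ≤ r * Real.exp (-r ^ 2 / (2 * v)) := fun r hr =>
    mul_nonneg (hb.trans (le_of_lt hr)) (Real.exp_pos _).le
  have hlim : Filter.Tendsto (fun r : ℝ => -v * Real.exp (-r ^ 2 / (2 * v))) Filter.atTop
      (nhds (-v * 0)) := by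
    refine Filter.Tendsto.const_mul _ (Real.tendsto_exp_atBot.comp ?_)
    simp_rw [neg_div]
    exact Filter.tendsto_neg_atTop_atBot.comp
      ((Filter.tendsto_pow_atTop two_ne_zero).atTop_div_const (by positivity))
  have hint := integrableOn_Ioi_deriv_of_nonneg' hderiv hnn hlim
  have hval := integral_Ioi_of_hasDerivAt_of_nonneg' hderiv hnn hlim
  rw [setLIntegral_congr Ioi_ae_eq_Ici.symm, ← ofReal_integral_eq_lintegral_ofReal hint
    ((ae_restrict_iff' measurableSet_Ioi).2 (.of_forall hnn)), hval]
  congr 1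
  ring

/-- Craig's formula for the tail of a centred Gaussian variable. -/
lemma gaussianReal_real_Ici_eq_integral {v : ℝ≥0} (hv : v ≠ 0) {a : ℝ} (ha : 0 < a) :
    (gaussianReal 0 v).real (Set.Ici a) =
      1 / Real.pi * ∫ θ in (0 : ℝ)..(Real.pi / 2),
        Real.exp (-a ^ 2 / (2 * v * Real.sin θ ^ 2)) := by
  have hv' : (0 : ℝ) < v := by positivity
  set g : ℝ → ℝ := fun θ => Real.exp (-a ^ 2 / (2 * v * Real.sin θ ^ 2)) with hg
  have hgm : Measurable g := by fun_prop
  have hg0 : ∀ θ, 0 ≤ g θ := fun θ => (Real.exp_pos _).le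
  have hg1 : ∀ θ, g θ ≤ 1 := fun θ => by
    refine Real.exp_le_one_iff.2 (div_nonpos_of_nonpos_of_nonneg ?_ (by positivity))
    nlinarith
  have hgi : ∀ x y, IntervalIntegrable g volume x y := fun x y =>
    intervalIntegrable_const (c := (1 : ℝ)) |>.mono_fun hgm.aestronglyMeasurable
      (.of_forall fun θ => by simpa [abs_of_nonneg (hg0 θ)] using hg1 θ)
  -- A second independent Gaussian coordinate turns the tail into a half-plane probability.
  set f : ℝ × ℝ → ENNReal := fun p =>
    gaussianPDF 0 v p.1 * (Set.Ici a).indicator (gaussianPDF 0 v) p.2 with hf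
  have hfm : Measurable f := by
    refine ((measurable_gaussianPDF 0 v).comp measurable_fst).mul
      (((measurable_gaussianPDF 0 v).indicator measurableSet_Ici).comp measurable_snd)
  have h1 : gaussianReal 0 v (Set.Ici a) = ∫⁻ p, f p := by
    rw [hf, Measure.volume_eq_prod, lintegral_prod_mul (measurable_gaussianPDF 0 v).aemeasurable
      ((measurable_gaussianPDF 0 v).indicator measurableSet_Ici).aemeasurable,
      lintegral_gaussianPDF_eq_one _ hv, one_mul, lintegral_indicator measurableSet_Ici,
      gaussianReal_apply _ hv]
  -- The radial integral: the ray of angle `θ` meets the half-plane `y ≥ a` only for `0 < θ < π`,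
  -- from the radius `a / sin θ` on.
  have hinner : ∀ θ ∈ Set.Ioo (-Real.pi) Real.pi,
      ∫⁻ r in Set.Ioi (0 : ℝ), ENNReal.ofReal r * f (r * Real.cos θ, r * Real.sin θ) =
        (Set.Ioo 0 Real.pi).indicator
          (fun θ => ENNReal.ofReal (1 / (2 * Real.pi) * g θ)) θ := by
    intro θ hθ
    by_cases h0 : 0 < θ
    · have hs : 0 < Real.sin θ := Real.sin_pos_of_pos_of_lt_pi h0 hθ.2
      rw [Set.indicator_of_mem (show θ ∈ Set.Ioo 0 Real.pi from ⟨h0, hθ.2⟩)]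
      have hpt : ∀ r ∈ Set.Ioi (0 : ℝ),
          ENNReal.ofReal r * f (r * Real.cos θ, r * Real.sin θ) =
            (Set.Ici (a / Real.sin θ)).indicator (fun r => ENNReal.ofReal (1 / (2 * Real.pi * v)) *
              ENNReal.ofReal (r * Real.exp (-r ^ 2 / (2 * v)))) r := by
        intro r hr
        have hr : 0 < r := hr
        by_cases hra : a / Real.sin θ ≤ r
        · have hra' : a ≤ r * Real.sin θ := (div_le_iff₀ hs).1 hra
          rw [Set.indicator_of_mem (show r ∈ Set.Ici _ from hra)]
          simp only [hf]
          rw [Set.indicator_of_mem (show r * Real.sin θ ∈ Set.Ici a from hra')]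
          simp only [gaussianPDF, gaussianPDFReal]
          rw [← ENNReal.ofReal_mul (by positivity), ← ENNReal.ofReal_mul (by positivity),
            ← ENNReal.ofReal_mul (by positivity)]
          congr 1
          have he : Real.exp (-r ^ 2 / (2 * v)) =
              Real.exp (-(r * Real.cos θ - 0) ^ 2 / (2 * v)) *
                Real.exp (-(r * Real.sin θ - 0) ^ 2 / (2 * v)) := by
            rw [← Real.exp_add]
            congr 1
            rw [← add_div]
            congr 1
            linear_combination (r ^ 2) * Real.sin_sq_add_cos_sq θ
          have hq : (√(2 * Real.pi * v))⁻¹ * (√(2 * Real.pi * v))⁻¹ = 1 / (2 * Real.pi * v) := by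
            rw [← mul_inv, Real.mul_self_sqrt (by positivity), one_div]
          rw [he, ← hq]
          ring
        · rw [Set.indicator_of_notMem (show r ∉ Set.Ici _ from hra)]
          simp only [hf]
          rw [Set.indicator_of_notMem, mul_zero, mul_zero]
          exact fun h => hra ((div_le_iff₀ hs).2 h)
      rw [setLIntegral_congr_fun measurableSet_Ioi hpt, setLIntegral_indicator measurableSet_Ici,
        Set.inter_eq_left.2 (Set.Ici_subset_Ioi.2 (div_pos ha hs)),
        lintegral_const_mul _ (by fun_prop), lintegral_Ici_mul_exp_neg_sq hv' (by positivity),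
        ← ENNReal.ofReal_mul (by positivity)]
      congr 1
      have : -(a / Real.sin θ) ^ 2 / (2 * v) = -a ^ 2 / (2 * v * Real.sin θ ^ 2) := by
        field_simp
      simp only [hg]
      rw [this]
      field_simp
    · rw [Set.indicator_of_notMem (fun h => h0 h.1), setLIntegral_congr_fun measurableSet_Ioi
        (g := fun _ => 0), lintegral_zero]
      intro r hr
      have hs : Real.sin θ ≤ 0 := Real.sin_nonpos_of_nonpos_of_neg_pi_le (not_lt.1 h0) hθ.1.le
      simp only [hf]
      rw [Set.indicator_of_notMem, mul_zero, mul_zero]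
      intro h
      have h : a ≤ r * Real.sin θ := h
      have := mul_nonpos_of_nonneg_of_nonpos (le_of_lt hr) hs
      linarith
  have h2 : gaussianReal 0 v (Set.Ici a) =
      ENNReal.ofReal (∫ θ in (0 : ℝ)..Real.pi, 1 / (2 * Real.pi) * g θ) := by
    rw [h1, ← lintegral_comp_polarCoord_symm]
    simp only [polarCoord_target, polarCoord_symm_apply, smul_eq_mul]
    rw [Measure.volume_eq_prod, ← Measure.prod_restrict, lintegral_prod_symm' _ (by fun_prop),
      setLIntegral_congr_fun measurableSet_Ioo hinner, setLIntegral_indicator measurableSet_Ioo,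
      Set.inter_eq_left.2 (Set.Ioo_subset_Ioo_left (by linarith [Real.pi_pos])),
      intervalIntegral.integral_of_le Real.pi_pos.le, setLIntegral_congr Ioo_ae_eq_Ioc,
      ofReal_integral_eq_lintegral_ofReal]
    · exact (((hgi 0 Real.pi).const_mul _).1)
    · refine .of_forall fun θ => ?_
      have := hg0 θ
      have := Real.pi_pos
      simp only [Pi.zero_apply]
      positivity
  have hpi := Real.pi_pos
  rw [measureReal_def, h2, ENNReal.toReal_ofReal
    (intervalIntegral.integral_nonneg hpi.le fun θ _ => mul_nonneg (by positivity) (hg0 θ)),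
    intervalIntegral.integral_const_mul,
    ← intervalIntegral.integral_add_adjacent_intervals (hgi 0 (Real.pi / 2)) (hgi _ _)]
  have hsymm : ∫ θ in (Real.pi / 2)..Real.pi, g θ = ∫ θ in (0 : ℝ)..(Real.pi / 2), g θ := by
    have := intervalIntegral.integral_comp_sub_left (a := 0) (b := Real.pi / 2) g Real.pi
    simp only [hg, Real.sin_pi_sub, sub_zero, sub_half] at this ⊢
    exact this.symm
  rw [hsymm]
  field_simp
  ring

/-! ### Half-space probabilities of the noise and averaging -/

/-- The probability that white noise `u` moves the received vector at least half of the way along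
`z`. The variable `Re (z† u)` is Gaussian of variance `σ² ‖z‖² / 2`. -/
lemma IsComplexGaussian.measureReal_half_sq_le_re {Ω n : Type*} [MeasurableSpace Ω] [Fintype n]
    [DecidableEq n] {P : Measure Ω} {σ : ℝ} (hσ : 0 < σ) {u : Ω → n → ℂ}
    (hu : IsComplexGaussian u 0 (((σ ^ 2 : ℝ) : ℂ) • (1 : Matrix n n ℂ)) P)
    {z : n → ℂ} (hz : z ≠ 0) :
    P.real {ω | (∑ l, ‖z l‖ ^ 2) / 2 ≤ (star z ⬝ᵥ u ω).re} =
      1 / Real.pi * ∫ θ in (0 : ℝ)..(Real.pi / 2),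
        Real.exp (-(1 / (4 * σ ^ 2 * Real.sin θ ^ 2)) * ∑ l, ‖z l‖ ^ 2) := by
  obtain ⟨-, hum, hlaw⟩ := hu
  set e : ℝ := ∑ l, ‖z l‖ ^ 2 with he
  have hepos : 0 < e := by
    obtain ⟨l, hl⟩ := Function.ne_iff.1 hz
    exact Finset.sum_pos' (fun _ _ => by positivity)
      ⟨l, Finset.mem_univ l, pow_pos (norm_pos_iff.2 hl) 2⟩
  have hzz : (star z ⬝ᵥ z).re = e := by
    rw [dotProduct, Complex.re_sum, he]
    refine Finset.sum_congr rfl fun i _ => ?_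
    rw [Pi.star_apply, Complex.star_def, ← Complex.normSq_eq_conj_mul_self, Complex.ofReal_re,
      Complex.normSq_eq_norm_sq]
  have h := hlaw z
  rw [Matrix.smul_mulVec, Matrix.one_mulVec, dotProduct_smul, smul_eq_mul, Complex.re_ofReal_mul,
    hzz, dotProduct_zero, Complex.zero_re] at h
  have hv : (Real.toNNReal (σ ^ 2 * e / 2) : ℝ) = σ ^ 2 * e / 2 :=
    Real.coe_toNNReal _ (by positivity)
  have hv0 : Real.toNNReal (σ ^ 2 * e / 2) ≠ 0 := by
    rw [← NNReal.coe_ne_zero, hv]; positivity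
  have hmeas : AEMeasurable (fun ω => (star z ⬝ᵥ u ω).re) P := by
    simp only [dotProduct]
    fun_prop
  have := gaussianReal_real_Ici_eq_integral hv0 (half_pos hepos)
  rw [← h, map_measureReal_apply_of_aemeasurable hmeas measurableSet_Ici, hv] at this
  refine this.trans ?_
  congr 2
  ext θ
  congr 1
  -- At `sin θ = 0` both exponents are `0` through division by zero.
  by_cases hs : Real.sin θ = 0
  · simp [hs]
  · field_simp
    ring

/-- The probability of a joint event of independent `X` and `Y` is computed by freezing the value of
`X`; a second copy `ω'` of the sample point carries `Y`. -/
lemma ProbabilityTheory.IndepFun.measureReal_preimage_eq_integral {Ω α β : Type*}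
    [MeasurableSpace Ω] [MeasurableSpace α] [MeasurableSpace β] {P : Measure Ω}
    [IsProbabilityMeasure P] {X : Ω → α} {Y : Ω → β} (hX : Measurable X) (hY : Measurable Y)
    (h : IndepFun X Y P) {s : Set (α × β)} (hs : MeasurableSet s) :
    Integrable (fun ω => P.real {ω' | (X ω, Y ω') ∈ s}) P ∧
      P.real {ω | (X ω, Y ω) ∈ s} = ∫ ω, P.real {ω' | (X ω, Y ω') ∈ s} ∂P := by
  have hsec : ∀ x, P {ω' | (x, Y ω') ∈ s} = P.map Y (Prod.mk x ⁻¹' s) := fun x =>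
    (Measure.map_apply hY (measurable_prodMk_left hs)).symm
  have := Measure.isProbabilityMeasure_map (μ := P) hY.aemeasurable
  have hm : Measurable fun x => P {ω' | (x, Y ω') ∈ s} := by
    simp_rw [hsec]
    exact measurable_measure_prodMk_left hs
  have hm' : Measurable fun ω => P {ω' | (X ω, Y ω') ∈ s} := hm.comp hX
  constructor
  · refine Integrable.of_bound hm'.ennreal_toReal.aestronglyMeasurable 1 (.of_forall fun ω => ?_)
    rw [Real.norm_of_nonneg measureReal_nonneg]
    exact measureReal_le_one
  · simp only [measureReal_def]
    rw [integral_toReal hm'.aemeasurable (.of_forall fun ω => measure_lt_top _ _)]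
    congr 1
    have h1 : P {ω | (X ω, Y ω) ∈ s} = P.map (fun ω => (X ω, Y ω)) s :=
      (Measure.map_apply (hX.prodMk hY) hs).symm
    rw [h1, (indepFun_iff_map_prod_eq_prod_map_map hX.aemeasurable hY.aemeasurable).1 h,
      Measure.prod_apply hs, lintegral_map (measurable_measure_prodMk_left hs) hX]
    simp_rw [hsec]

lemma integral_intervalIntegral_exp_swap {Ω : Type*} [MeasurableSpace Ω] {P : Measure Ω}
    [IsProbabilityMeasure P] {Q : Ω → ℝ} (hQ : Measurable Q) (hQ0 : ∀ ω, 0 ≤ Q ω) (σ : ℝ) :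
    Integrable (fun ω => ∫ θ in (0 : ℝ)..(Real.pi / 2),
        Real.exp (-(1 / (4 * σ ^ 2 * Real.sin θ ^ 2)) * Q ω)) P ∧
      ∫ ω, (∫ θ in (0 : ℝ)..(Real.pi / 2),
        Real.exp (-(1 / (4 * σ ^ 2 * Real.sin θ ^ 2)) * Q ω)) ∂P =
      ∫ θ in (0 : ℝ)..(Real.pi / 2),
        ∫ ω, Real.exp (-(1 / (4 * σ ^ 2 * Real.sin θ ^ 2)) * Q ω) ∂P := by
  have hint : Integrable (Function.uncurry fun ω θ =>
      Real.exp (-(1 / (4 * σ ^ 2 * Real.sin θ ^ 2)) * Q ω))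
      (P.prod (volume.restrict (Set.Ioc 0 (Real.pi / 2)))) := by
    refine Integrable.of_bound (Measurable.aestronglyMeasurable ?_) 1 (.of_forall fun p => ?_)
    · unfold Function.uncurry
      fun_prop
    · simp only [Function.uncurry]
      rw [Real.norm_of_nonneg (Real.exp_pos _).le, Real.exp_le_one_iff, neg_mul, neg_nonpos]
      have := hQ0 p.1
      positivity
  simp_rw [intervalIntegral.integral_of_le (half_pos Real.pi_pos).le]
  exact ⟨hint.integral_prod_left, integral_integral_swap hint⟩

/-! ### Pairwise errors of the maximum likelihood detector -/

namespace SCM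

variable {M k q : ℕ}

lemma quadMatrix_posSemidef (S : SCM M k q) (N : ℕ) (i j : Fin (k + q) → Bool) :
    (S.quadMatrix N i j).PosSemidef :=
  Matrix.PosSemidef.one.kronecker (Matrix.posSemidef_vecMulVec_self_star _)

/-- `‖h δ‖²` is the quadratic form of `A_ij` at `vec (h†)`. The conjugation in `vec (h†)` is harmless:
the entries of `(1 ⊗ δ†) vec (h†)` are the conjugates of those of `h δ`. -/
lemma star_vec_dotProduct_quadMatrix_mulVec (S : SCM M k q) {N : ℕ} (i j : Fin (k + q) → Bool)
    (h : Matrix (Fin N) (Fin M) ℂ) :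
    (star (Matrix.vec hᴴ) ⬝ᵥ (S.quadMatrix N i j *ᵥ Matrix.vec hᴴ)).re =
      ∑ n, ‖(h *ᵥ S.delta i j) n‖ ^ 2 := by
  have hmul : S.quadMatrix N i j *ᵥ Matrix.vec hᴴ =
      fun p => S.delta i j p.2 * star ((h *ᵥ S.delta i j) p.1) := by
    ext ⟨n, l⟩
    simp [SCM.quadMatrix, Matrix.mulVec, dotProduct, Fintype.sum_prod_type, Matrix.one_apply,
      Matrix.vecMulVec_apply, Finset.mul_sum, Matrix.vec]
    exact Finset.sum_congr rfl fun _ _ => by ring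
  rw [hmul, dotProduct, Fintype.sum_prod_type, Complex.re_sum]
  refine Finset.sum_congr rfl fun n _ => ?_
  have : ∑ l, star (Matrix.vec hᴴ) (n, l) * (S.delta i j l * star ((h *ᵥ S.delta i j) n)) =
      (h *ᵥ S.delta i j) n * star ((h *ᵥ S.delta i j) n) := by
    simp_rw [← mul_assoc]
    rw [← Finset.sum_mul]
    congr 1
    simp [Matrix.mulVec, dotProduct, Matrix.vec]
  rw [this, Complex.star_def, Complex.mul_conj, Complex.ofReal_re, Complex.normSq_eq_norm_sq]

/-- If `i` is sent and `j` decided, then the noise has moved the received vector at least half of the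
way from `h x_i` to `h x_j`. -/
lemma IsMLDetector.half_sq_le_re {S : SCM M k q} {N : ℕ}
    {D : Matrix (Fin N) (Fin M) ℂ → (Fin N → ℂ) → (Fin (k + q) → Bool)} (hD : S.IsMLDetector D)
    {h : Matrix (Fin N) (Fin M) ℂ} {i j : Fin (k + q) → Bool} {w : Fin N → ℂ}
    (hw : D h (h *ᵥ S.symbol i + w) = j) :
    (∑ n, ‖(h *ᵥ S.delta i j) n‖ ^ 2) / 2 ≤ (star (-(h *ᵥ S.delta i j)) ⬝ᵥ w).re := by
  have hle := hD.2 h (h *ᵥ S.symbol i + w) i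
  rw [hw] at hle
  have e1 : h *ᵥ S.symbol i + w - h *ᵥ S.symbol j = h *ᵥ S.delta i j + w := by
    rw [SCM.delta, Matrix.mulVec_sub]; abel
  have e2 : h *ᵥ S.symbol i + w - h *ᵥ S.symbol i = w := by abel
  rw [e1, e2, EuclideanSpace.norm_sq_eq, EuclideanSpace.norm_sq_eq] at hle
  set z := h *ᵥ S.delta i j
  have hz : ∑ n, ‖(z + w) n‖ ^ 2 =
      ∑ n, ‖z n‖ ^ 2 + ∑ n, ‖w n‖ ^ 2 + 2 * (star z ⬝ᵥ w).re := by
    rw [dotProduct, Complex.re_sum, Finset.mul_sum, ← Finset.sum_add_distrib,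
      ← Finset.sum_add_distrib]
    refine Finset.sum_congr rfl fun n _ => ?_
    simp only [Pi.add_apply, Pi.star_apply, ← Complex.normSq_eq_norm_sq, Complex.normSq_apply,
      Complex.add_re, Complex.add_im, Complex.mul_re, Complex.star_def, Complex.conj_re,
      Complex.conj_im]
    ring
  have hle : ∑ n, ‖(z + w) n‖ ^ 2 ≤ ∑ n, ‖w n‖ ^ 2 := hle
  rw [star_neg, neg_dotProduct, Complex.neg_re]
  linarith

/-- The pairwise error bound for a fixed channel, for both orders of the pair together. The sum is
needed: when `h x_i = h x_j`, one of the two probabilities alone may be `1`. -/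
lemma IsMLDetector.pairwise_error_add_le {S : SCM M k q} {N : ℕ} {Ω : Type*} [MeasurableSpace Ω]
    {P : Measure Ω} [IsProbabilityMeasure P]
    {D : Matrix (Fin N) (Fin M) ℂ → (Fin N → ℂ) → (Fin (k + q) → Bool)} (hD : S.IsMLDetector D)
    {σ : ℝ} (hσ : 0 < σ) {u : Ω → Fin N → ℂ} (hum : Measurable u)
    (hu : IsComplexGaussian u 0 (((σ ^ 2 : ℝ) : ℂ) • (1 : Matrix (Fin N) (Fin N) ℂ)) P)
    (h : Matrix (Fin N) (Fin M) ℂ) {i j : Fin (k + q) → Bool} (hij : i ≠ j) :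
    P.real {ω | D h (h *ᵥ S.symbol i + u ω) = j} + P.real {ω | D h (h *ᵥ S.symbol j + u ω) = i} ≤
      2 * (1 / Real.pi * ∫ θ in (0 : ℝ)..(Real.pi / 2),
        Real.exp (-(1 / (4 * σ ^ 2 * Real.sin θ ^ 2)) * ∑ n, ‖(h *ᵥ S.delta i j) n‖ ^ 2)) := by
  by_cases hz : h *ᵥ S.delta i j = 0
  · have hsym : h *ᵥ S.symbol i = h *ᵥ S.symbol j := by
      rwa [SCM.delta, Matrix.mulVec_sub, sub_eq_zero] at hz
    have hdm : Measurable fun ω => D h (h *ᵥ S.symbol j + u ω) :=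
      hD.1.comp (measurable_const.prodMk (hum.const_add _))
    have hdisj : Disjoint {ω | D h (h *ᵥ S.symbol j + u ω) = j}
        {ω | D h (h *ᵥ S.symbol j + u ω) = i} :=
      Set.disjoint_left.2 fun ω (h1 : _ = j) (h2 : _ = i) => hij (h2.symm.trans h1)
    rw [hsym, ← measureReal_union hdisj (hdm (measurableSet_singleton i)), hz]
    refine measureReal_le_one.trans_eq ?_
    -- At `h δ = 0` the integrand is `1`, so that the bound is `2 * (1 / π) * (π / 2) = 1`.
    have := Real.pi_ne_zero
    simp
    field_simp
  · have hle : ∀ a b : Fin (k + q) → Bool, h *ᵥ S.delta a b ≠ 0 →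
        P.real {ω | D h (h *ᵥ S.symbol a + u ω) = b} ≤
          1 / Real.pi * ∫ θ in (0 : ℝ)..(Real.pi / 2),
            Real.exp (-(1 / (4 * σ ^ 2 * Real.sin θ ^ 2)) *
              ∑ n, ‖(h *ᵥ S.delta a b) n‖ ^ 2) := by
      intro a b hab
      have := hu.measureReal_half_sq_le_re hσ (neg_ne_zero.2 hab)
      simp only [Pi.neg_apply, norm_neg] at this
      rw [← this]
      exact measureReal_mono fun ω hω => hD.half_sq_le_re hω
    have hneg : h *ᵥ S.delta j i = -(h *ᵥ S.delta i j) := by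
      rw [← Matrix.mulVec_neg, SCM.delta, SCM.delta, neg_sub]
    have h1 := hle i j hz
    have h2 := hle j i (by rw [hneg]; exact neg_ne_zero.2 hz)
    simp only [hneg, Pi.neg_apply, norm_neg] at h2
    linarith

/-- The pairwise error bound averaged over the channel; the right-hand side is the integral that
occurs in `SCM.G`. -/
lemma IsMLDetector.averaged_pairwise_error_add_le {S : SCM M k q} {N : ℕ} {Ω : Type*}
    [MeasurableSpace Ω] {P : Measure Ω} [IsProbabilityMeasure P]
    {D : Matrix (Fin N) (Fin M) ℂ → (Fin N → ℂ) → (Fin (k + q) → Bool)} (hD : S.IsMLDetector D)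
    {σ : ℝ} (hσ : 0 < σ) {μ : Fin N × Fin M → ℂ} {C : Matrix (Fin N × Fin M) (Fin N × Fin M) ℂ}
    {H : Ω → Matrix (Fin N) (Fin M) ℂ} {u : Ω → Fin N → ℂ} (hH : Measurable H) (hu : Measurable u)
    (H_law : IsComplexGaussian (fun ω => Matrix.vec (H ω)ᴴ) μ C P)
    (u_law : IsComplexGaussian u 0 (((σ ^ 2 : ℝ) : ℂ) • (1 : Matrix (Fin N) (Fin N) ℂ)) P)
    (hHu : IndepFun H u P) {i j : Fin (k + q) → Bool} (hij : i ≠ j) :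
    P.real {ω | D (H ω) (H ω *ᵥ S.symbol i + u ω) = j} +
        P.real {ω | D (H ω) (H ω *ᵥ S.symbol j + u ω) = i} ≤
      2 * (1 / Real.pi * ∫ θ in (0 : ℝ)..(Real.pi / 2),
        Real.exp (-(1 / (4 * σ ^ 2 * Real.sin θ ^ 2)) *
          (star μ ⬝ᵥ ((S.quadMatrix N i j *
            (1 + ((1 / (4 * σ ^ 2 * Real.sin θ ^ 2) : ℝ) : ℂ) • (C * S.quadMatrix N i j))⁻¹)
              *ᵥ μ)).re) /
        (1 + ((1 / (4 * σ ^ 2 * Real.sin θ ^ 2) : ℝ) : ℂ) •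
          (C * S.quadMatrix N i j)).det.re) := by
  have hent : ∀ n l, Measurable fun ω => H ω n l := fun n l =>
    (measurable_pi_apply l).comp ((measurable_pi_apply n).comp hH)
  have hset : ∀ a b : Fin (k + q) → Bool, MeasurableSet
      {p : Matrix (Fin N) (Fin M) ℂ × (Fin N → ℂ) | D p.1 (p.1 *ᵥ S.symbol a + p.2) = b} := by
    intro a b
    have hmul : Measurable fun p : Matrix (Fin N) (Fin M) ℂ × (Fin N → ℂ) =>
        p.1 *ᵥ S.symbol a := by
      refine measurable_pi_lambda _ fun n => ?_
      simp only [Matrix.mulVec, dotProduct]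
      exact Finset.measurable_sum _ fun l _ =>
        ((measurable_pi_apply l).comp ((measurable_pi_apply n).comp measurable_fst)).mul_const _
    exact hD.1.comp (measurable_fst.prodMk (hmul.add measurable_snd)) (measurableSet_singleton b)
  have hsplit := fun a b : Fin (k + q) → Bool =>
    hHu.measureReal_preimage_eq_integral hH hu (hset a b)
  simp only [Set.mem_ofPred_eq] at hsplit
  have hQm : Measurable fun ω => ∑ n, ‖(H ω *ᵥ S.delta i j) n‖ ^ 2 := by
    simp only [Matrix.mulVec, dotProduct]
    fun_prop
  obtain ⟨hint, hswap⟩ := integral_intervalIntegral_exp_swap (P := P) hQm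
    (fun ω => by positivity) σ
  have hmgf : ∀ θ : ℝ, ∫ ω, Real.exp (-(1 / (4 * σ ^ 2 * Real.sin θ ^ 2)) *
      ∑ n, ‖(H ω *ᵥ S.delta i j) n‖ ^ 2) ∂P = _ := fun θ => by
    simp_rw [← star_vec_dotProduct_quadMatrix_mulVec]
    exact H_law.integral_exp_neg_quadForm (S.quadMatrix_posSemidef N i j)
      (s := 1 / (4 * σ ^ 2 * Real.sin θ ^ 2)) (by positivity)
  simp_rw [← hmgf]
  rw [← hswap, (hsplit i j).2, (hsplit j i).2, ← integral_add (hsplit i j).1 (hsplit j i).1,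
    ← integral_const_mul, ← integral_const_mul]
  exact integral_mono ((hsplit i j).1.add (hsplit j i).1) ((hint.const_mul _).const_mul _)
    fun ω => hD.pairwise_error_add_le hσ hu u_law (H ω) hij

/-! ### Bit error rate -/

/-- The expected number of wrong bits, grouped by the sent and the decided message. -/
lemma sum_measureReal_ne_eq {Ω : Type*} [MeasurableSpace Ω] {P : Measure Ω}
    [IsProbabilityMeasure P] {n : ℕ} {m d : Ω → Fin n → Bool} (hm : Measurable m)
    (hd : Measurable d) :
    ∑ t, P.real {ω | d ω t ≠ m ω t} =
      ∑ i, ∑ j, (hammingDist i j : ℝ) * P.real {ω | m ω = i ∧ d ω = j} := by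
  have hmd : Measurable fun ω => (m ω, d ω) := hm.prodMk hd
  have hbit : ∀ t, P.real {ω | d ω t ≠ m ω t} =
      ∑ p : (Fin n → Bool) × (Fin n → Bool),
        if p.1 t ≠ p.2 t then P.real {ω | m ω = p.1 ∧ d ω = p.2} else 0 := by
    intro t
    rw [← Finset.sum_filter]
    have := sum_measureReal_preimage_singleton (μ := P)
      (Finset.univ.filter fun p : (Fin n → Bool) × (Fin n → Bool) => p.1 t ≠ p.2 t)
      (f := fun ω => (m ω, d ω)) (fun p _ => hmd (measurableSet_singleton p))
    simp only [Set.preimage, Set.mem_singleton_iff, Prod.ext_iff] at this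
    rw [this]
    congr 1
    ext ω
    simp [ne_comm]
  simp_rw [hbit]
  rw [Finset.sum_comm, Fintype.sum_prod_type]
  refine Finset.sum_congr rfl fun i _ => Finset.sum_congr rfl fun j _ => ?_
  rw [← Finset.sum_filter, Finset.sum_const, nsmul_eq_mul, hammingDist]

/-- For symmetric weights `d`, a bound on `e i j + e j i` suffices to bound `∑ d i j * e i j`. -/
lemma sum_mul_le_of_add_swap_le {ι : Type*} [Fintype ι] {d e b : ι → ι → ℝ}
    (hd : ∀ i j, 0 ≤ d i j) (hsymm : ∀ i j, d i j = d j i)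
    (h : ∀ i j, d i j ≠ 0 → e i j + e j i ≤ 2 * b i j) :
    ∑ i, ∑ j, d i j * e i j ≤ ∑ i, ∑ j, d i j * b i j := by
  have hswap : ∑ i, ∑ j, d i j * e i j = ∑ i, ∑ j, d i j * e j i := by
    rw [Finset.sum_comm]
    exact Finset.sum_congr rfl fun i _ => Finset.sum_congr rfl fun j _ => by rw [hsymm]
  have hle : ∑ i, ∑ j, (d i j * e i j + d i j * e j i) ≤ ∑ i, ∑ j, 2 * (d i j * b i j) := by
    refine Finset.sum_le_sum fun i _ => Finset.sum_le_sum fun j _ => ?_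
    by_cases h0 : d i j = 0
    · simp [h0]
    · nlinarith [mul_le_mul_of_nonneg_left (h i j h0) (hd i j)]
  simp only [Finset.sum_add_distrib, ← Finset.mul_sum] at hle
  linarith

/-- The bit error rate in terms of the pairwise decision probabilities of a fixed sent message. -/
lemma ber_eq (S : SCM M k q) {N : ℕ} {Ω : Type*} [MeasurableSpace Ω] {P : Measure Ω}
    [IsProbabilityMeasure P] {D : Matrix (Fin N) (Fin M) ℂ → (Fin N → ℂ) → (Fin (k + q) → Bool)}
    (hD : Measurable (Function.uncurry D)) {m : Ω → Fin (k + q) → Bool}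
    {H : Ω → Matrix (Fin N) (Fin M) ℂ} {u : Ω → Fin N → ℂ}
    (hm : Measurable m) (hH : Measurable H) (hu : Measurable u)
    (m_unif : ∀ b, P.real {ω | m ω = b} = 1 / 2 ^ (k + q))
    (hmHu : IndepFun m (fun ω => (H ω, u ω)) P) :
    S.ber P D m H u = 1 / (2 ^ (k + q) * ((k + q : ℕ) : ℝ)) * ∑ i, ∑ j, (hammingDist i j : ℝ) *
      P.real {ω | D (H ω) (H ω *ᵥ S.symbol i + u ω) = j} := by
  have hrec : Measurable fun p : (Fin (k + q) → Bool) × Matrix (Fin N) (Fin M) ℂ × (Fin N → ℂ) =>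
      D p.2.1 (p.2.1 *ᵥ S.symbol p.1 + p.2.2) := by
    have hsym : Measurable S.symbol := measurable_of_finite _
    have hmul : Measurable
        fun p : (Fin (k + q) → Bool) × Matrix (Fin N) (Fin M) ℂ × (Fin N → ℂ) =>
          p.2.1 *ᵥ S.symbol p.1 := by
      refine measurable_pi_lambda _ fun n => ?_
      simp only [Matrix.mulVec, dotProduct]
      exact Finset.measurable_sum _ fun l _ => ((measurable_pi_apply l).comp
        ((measurable_pi_apply n).comp (measurable_fst.comp measurable_snd))).mul
          ((measurable_pi_apply l).comp (hsym.comp measurable_fst))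
    exact hD.comp ((measurable_fst.comp measurable_snd).prodMk
      (hmul.add (measurable_snd.comp measurable_snd)))
  rw [SCM.ber, sum_measureReal_ne_eq (P := P)
    (d := fun ω => D (H ω) (H ω *ᵥ S.symbol (m ω) + u ω)) hm
    (hrec.comp (hm.prodMk (hH.prodMk hu))), Finset.mul_sum,
    Finset.sum_div]
  refine Finset.sum_congr rfl fun i _ => ?_
  rw [Finset.mul_sum, Finset.sum_div]
  refine Finset.sum_congr rfl fun j _ => ?_
  have hset : {ω | m ω = i ∧ D (H ω) (H ω *ᵥ S.symbol (m ω) + u ω) = j} =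
      m ⁻¹' {i} ∩ (fun ω => (H ω, u ω)) ⁻¹'
        {p | D p.1 (p.1 *ᵥ S.symbol i + p.2) = j} := by
    ext ω
    constructor
    · rintro ⟨rfl, h⟩
      exact ⟨rfl, h⟩
    · rintro ⟨h1, h⟩
      obtain rfl : m ω = i := h1
      exact ⟨rfl, h⟩
  have hindep := hmHu.measure_inter_preimage_eq_mul {i}
    {p | D p.1 (p.1 *ᵥ S.symbol i + p.2) = j} (measurableSet_singleton i)
    ((hrec.comp (measurable_const.prodMk measurable_id)) (measurableSet_singleton j))
  have hprod : P.real {ω | m ω = i ∧ D (H ω) (H ω *ᵥ S.symbol (m ω) + u ω) = j} =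
      1 / 2 ^ (k + q) * P.real {ω | D (H ω) (H ω *ᵥ S.symbol i + u ω) = j} := by
    rw [← m_unif i, hset, measureReal_def, hindep, ENNReal.toReal_mul]
    rfl
  refine (congrArg (fun x => (hammingDist i j : ℝ) * x / ((k + q : ℕ) : ℝ)) hprod).trans ?_
  rw [one_div, one_div, mul_inv]
  ring

end SCM

theorem lemma3 {M N k q : ℕ} (hbits : 0 < k + q) (S : SCM M k q)
    {Ω : Type*} [MeasurableSpace Ω] (P : Measure Ω) [IsProbabilityMeasure P]
    (σ : ℝ) (hσ : 0 < σ)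
    (μ : Fin N × Fin M → ℂ) (C : Matrix (Fin N × Fin M) (Fin N × Fin M) ℂ)
    (m : Ω → Fin (k + q) → Bool) (H : Ω → Matrix (Fin N) (Fin M) ℂ) (u : Ω → Fin N → ℂ)
    (hm : Measurable m) (hH : Measurable H) (hu : Measurable u)
    (m_unif : ∀ b, P.real {ω | m ω = b} = 1 / 2 ^ (k + q))
    (H_law : IsComplexGaussian (fun ω => Matrix.vec (H ω)ᴴ) μ C P)
    (u_law : IsComplexGaussian u 0 (((σ ^ 2 : ℝ) : ℂ) • (1 : Matrix (Fin N) (Fin N) ℂ)) P)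
    (hHu : IndepFun H u P) (hmHu : IndepFun m (fun ω => (H ω, u ω)) P)
    (D : Matrix (Fin N) (Fin M) ℂ → (Fin N → ℂ) → (Fin (k + q) → Bool))
    (hD : S.IsMLDetector D) :
    S.ber P D m H u ≤
      1 / (Real.pi * 2 ^ (k + q) * Real.logb 2 (2 ^ (k + q))) * S.G σ μ C := by
  have hlog : Real.logb 2 (2 ^ (k + q)) = ((k + q : ℕ) : ℝ) := by
    rw [Real.logb_pow, Real.logb_self_eq_one one_lt_two, mul_one]
  have hpos : (0 : ℝ) < ((k + q : ℕ) : ℝ) := Nat.cast_pos.2 hbits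
  rw [S.ber_eq hD.1 hm hH hu m_unif hmHu, hlog]
  have key := SCM.sum_mul_le_of_add_swap_le
    (d := fun i j : Fin (k + q) → Bool => (hammingDist i j : ℝ))
    (fun _ _ => Nat.cast_nonneg _) (fun i j => by rw [hammingDist_comm])
    (fun i j h0 => hD.averaged_pairwise_error_add_le hσ hH hu H_law u_law hHu
      (i := i) (j := j) (by rintro rfl; simp at h0))
  refine (mul_le_mul_of_nonneg_left key (by positivity)).trans_eq ?_
  rw [SCM.G, Finset.mul_sum, Finset.mul_sum]
  refine Finset.sum_congr rfl fun i _ => ?_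
  rw [Finset.mul_sum, Finset.mul_sum]
  refine Finset.sum_congr rfl fun j _ => ?_
  have := Real.pi_pos
  field_simp
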